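/- For a positive integer $p$ and a finite simple graph $G=(V,E)$, a set $D\subseteq V$ is $p$-dominating if every vertex in $V\setminus D$ has at least $p$ neighbours in $D$, and $\gamma_p(G)$ denotes the minimum cardinality of a $p$-dominating set of $G$. The $p$-bondage number $b_p(G)$ is the minimum cardinality of a set $B\subseteq E$ such that $\gamma_p(G-B)>\gamma_p(G)$, where $G-B$ is obtained from $G$ by deleting the edges in $B$ and keeping all vertices. Let $G_{4,n}=P_4\times P_n$ be the $4\times n$ grid graph (the Cartesian product of the paths on $4$ and on $n$ vertices). Then for every integer $n\ge 7$, $$b_2(G_{4,n})=\begin{cases}1 & \text{if } n\equiv 3 \pmod 4,\\ 2 & \text{otherwise.}\end{cases}$$ -/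

import Mathlib

open scoped SimpleGraph

/-- `D` is a `p`-dominating set of `G`: every vertex outside `D` has at least `p` neighbours
in `D`. -/
def IsPDominating {V : Type*} (G : SimpleGraph V) (p : ℕ) (D : Finset V) : Prop :=
  ∀ v, v ∉ D → p ≤ ((D : Set V) ∩ G.neighborSet v).ncard

/-- The `p`-domination number of a finite graph: the minimum cardinality of a `p`-dominating set.
The set of cardinalities is never empty, since the whole vertex set is `p`-dominating. -/
noncomputable def pDominationNumber {V : Type*} [Fintype V] (G : SimpleGraph V) (p : ℕ) : ℕ :=
  sInf {k : ℕ | ∃ D : Finset V, IsPDominating G p D ∧ D.card = k}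

/-- The `p`-bondage number of a finite graph: the minimum cardinality of a set `B` of edges of `G`
with `γ_p(G - B) > γ_p(G)`. The empty set of edges never qualifies, so the value is positive
whenever some `B` qualifies; it is `0` exactly when no `B` does. -/
noncomputable def pBondageNumber {V : Type*} [Fintype V] (G : SimpleGraph V) (p : ℕ) : ℕ :=
  sInf {k : ℕ | ∃ B : Finset (Sym2 V), (B : Set (Sym2 V)) ⊆ G.edgeSet ∧
    pDominationNumber G p < pDominationNumber (G.deleteEdges (B : Set (Sym2 V))) p ∧ B.card = k}

/-- The `m × n` grid graph `P_m □ P_n`, the Cartesian product of two paths. -/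
abbrev gridGraph (m n : ℕ) : SimpleGraph (Fin m × Fin n) :=
  SimpleGraph.pathGraph m □ SimpleGraph.pathGraph n

/-! Whether a column is 2-dominated depends only on three consecutive column masks of `D` and on the
surviving edges there. Lower bounds on `D.card` are therefore shortest-path estimates on pairs of
consecutive masks. A potential on such pairs telescopes to `7 * n + K ≤ 4 * D.card`
(`le_sum_maskCard_of_potential`), and its local inequality is a finite check. This gives `K = 3` for
the grid, `K = 4` after deleting a suitable vertical edge, and `K = 7` after deleting a suitable
pair of horizontal edges.

Explicit sets of size ⌊(7n+6)/4⌋ = ⌈(7n+3)/4⌉ show that the first bound is sharp. The bound with `K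
= 7` always exceeds this value, so two edges suffice; the bound with `K = 4` exceeds it exactly when
4 divides 7n+3, that is, when n ≡ 3 mod 4.

For other n no single edge suffices. An optimal set consists of a core of 4q-1 columns, q =
⌊(n+1)/4⌋, and r = (n+1) mod 4 > 0 spare alternating columns, s on the left and r-s on the right.
Varying s and reflecting the rows yields, for every edge, an optimal set that stays 2-dominating
without it. The core has period 8, so finitely many n need checking. -/

/-! ### Domination in terms of column masks -/

/-- The number of neighbours in `D` of the vertex in row `i` of a column with mask `b`, when the
columns before and after it have masks `a` and `c`; the masks `v`, `hl`, `hr` record which of the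
vertical, left and right edges at the column are present. -/
def neighbourCount (v hl hr a b c i : ℕ) : ℕ :=
  (a.testBit i && hl.testBit i).toNat + (c.testBit i && hr.testBit i).toNat +
    (decide (0 < i) && b.testBit (i - 1) && v.testBit (i - 1)).toNat +
    (decide (i < 3) && b.testBit (i + 1) && v.testBit i).toNat

/-- Every vertex of a column with mask `b` is in `D` or has two neighbours in `D`. -/
def columnOK (v hl hr a b c : ℕ) : Bool :=
  (List.range 4).all fun i => b.testBit i || decide (2 ≤ neighbourCount v hl hr a b c i)

theorem columnOK_iff {v hl hr a b c : ℕ} : columnOK v hl hr a b c = true ↔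
    ∀ i : Fin 4, b.testBit i = false → 2 ≤ neighbourCount v hl hr a b c i := by
  simp only [columnOK, List.all_eq_true, List.mem_range, Bool.or_eq_true, decide_eq_true_eq]
  constructor
  · intro h i hi
    rcases h i i.2 with h | h
    · simp [hi] at h
    · exact h
  · intro h i hi
    cases hb : b.testBit i
    · exact Or.inr (h ⟨i, hi⟩ hb)
    · exact Or.inl rfl

theorem Set.ncard_eq_toNat {α : Type*} {s : Set α} {b : Bool}
    (h1 : b = true → ∃ x, s = {x}) (h0 : b = false → s = ∅) : s.ncard = b.toNat := by
  cases b
  · simp [h0 rfl]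
  · obtain ⟨x, hx⟩ := h1 rfl
    simp [hx]

theorem Set.ncard_union_four {α : Type*} [Finite α] {s t u w : Set α} (hst : Disjoint s t)
    (hsu : Disjoint (s ∪ t) u) (hsw : Disjoint (s ∪ t ∪ u) w) :
    (s ∪ t ∪ u ∪ w).ncard = s.ncard + t.ncard + u.ncard + w.ncard := by
  rw [Set.ncard_union_eq hsw (Set.toFinite _) (Set.toFinite _),
    Set.ncard_union_eq hsu (Set.toFinite _) (Set.toFinite _),
    Set.ncard_union_eq hst (Set.toFinite _) (Set.toFinite _)]

/-- `c` lists the column masks of `D`, shifted by one and with empty columns at both ends. -/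
structure IsColumnMask {n : ℕ} (D : Finset (Fin 4 × Fin n)) (c : ℕ → ℕ) : Prop where
  first : c 0 = 0
  last : c (n + 1) = 0
  testBit : ∀ (i : Fin 4) (j : Fin n), (c (j + 1)).testBit i = true ↔ (i, j) ∈ D

/-- `v` and `h` record the edges of the grid that are not in `B`: bit `i` of `v j` is the edge
between rows `i` and `i + 1` of column `j`, and bit `i` of `h (j + 1)` is the edge in row `i`
between the columns `j` and `j + 1`. -/
structure IsEdgeMask (n : ℕ) (B : Set (Sym2 (Fin 4 × Fin n))) (v h : ℕ → ℕ) : Prop where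
  vert : ∀ (i k : Fin 4) (j : Fin n), i.val + 1 = k.val →
    ((v j).testBit i = true ↔ s((i, j), (k, j)) ∉ B)
  horiz : ∀ (i : Fin 4) (j k : Fin n), j.val + 1 = k.val →
    ((h k).testBit i = true ↔ s((i, j), (i, k)) ∉ B)

/-- The neighbours split by direction into left, right, up and down; each direction holds at most
one vertex, so each contributes one bit. -/
theorem ncard_inter_neighborSet {n : ℕ} {B : Set (Sym2 (Fin 4 × Fin n))} {v h c : ℕ → ℕ}
    {D : Finset (Fin 4 × Fin n)} (hB : IsEdgeMask n B v h) (hD : IsColumnMask D c)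
    (i : Fin 4) (j : Fin n) :
    ((D : Set (Fin 4 × Fin n)) ∩ ((gridGraph 4 n).deleteEdges B).neighborSet (i, j)).ncard =
      neighbourCount (v j) (h j) (h (j + 1)) (c j) (c (j + 1)) (c (j + 2)) i := by
  have key : (D : Set (Fin 4 × Fin n)) ∩ ((gridGraph 4 n).deleteEdges B).neighborSet (i, j) =
      {x | x ∈ D ∧ s((i, j), x) ∉ B ∧ x.1 = i ∧ x.2.val + 1 = j.val} ∪
      {x | x ∈ D ∧ s((i, j), x) ∉ B ∧ x.1 = i ∧ j.val + 1 = x.2.val} ∪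
      {x | x ∈ D ∧ s((i, j), x) ∉ B ∧ x.2 = j ∧ x.1.val + 1 = i.val} ∪
      {x | x ∈ D ∧ s((i, j), x) ∉ B ∧ x.2 = j ∧ i.val + 1 = x.1.val} := by
    ext ⟨i', j'⟩
    simp only [Set.mem_inter_iff, Finset.mem_coe, SimpleGraph.mem_neighborSet,
      SimpleGraph.deleteEdges_adj, SimpleGraph.boxProd_adj, SimpleGraph.pathGraph_adj,
      Set.mem_union, Set.mem_ofPred_eq]
    constructor
    · rintro ⟨h1, h2 | h2, h3⟩
      · rcases h2 with ⟨h2 | h2, h4⟩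
        · exact Or.inr ⟨h1, h3, h4.symm, h2⟩
        · exact Or.inl (Or.inr ⟨h1, h3, h4.symm, h2⟩)
      · rcases h2 with ⟨h2 | h2, h4⟩
        · exact Or.inl (Or.inl (Or.inr ⟨h1, h3, h4.symm, h2⟩))
        · exact Or.inl (Or.inl (Or.inl ⟨h1, h3, h4.symm, h2⟩))
    · rintro (((⟨h1, h2, h3, h4⟩ | ⟨h1, h2, h3, h4⟩) | ⟨h1, h2, h3, h4⟩) | ⟨h1, h2, h3, h4⟩)
      · exact ⟨h1, Or.inr ⟨Or.inr h4, h3.symm⟩, h2⟩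
      · exact ⟨h1, Or.inr ⟨Or.inl h4, h3.symm⟩, h2⟩
      · exact ⟨h1, Or.inl ⟨Or.inr h4, h3.symm⟩, h2⟩
      · exact ⟨h1, Or.inl ⟨Or.inl h4, h3.symm⟩, h2⟩
  rw [key, Set.ncard_union_four, neighbourCount]
  · congr 1
    · congr 1
      · congr 1
        · apply Set.ncard_eq_toNat
          · intro hb
            rw [Bool.and_eq_true] at hb
            obtain ⟨j', hj'⟩ : ∃ j' : Fin n, j'.val + 1 = j.val := by
              rcases Nat.eq_zero_or_pos j.val with h0 | h0
              -- In the first column the left mask is empty, so the bits of `h 0`, which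
              -- `IsEdgeMask` leaves free, are harmless; likewise `h n` in the last column.
              · simp [h0, hD.first] at hb
              · exact ⟨⟨j.val - 1, by omega⟩, Nat.succ_pred_eq_of_pos h0⟩
            have h1 := hb.1
            rw [← hj', hD.testBit] at h1
            have h2 := (hB.horiz i j' j hj').1 hb.2
            refine ⟨(i, j'), ?_⟩
            ext ⟨x, y⟩
            simp only [Set.mem_ofPred_eq, Set.mem_singleton_iff, Prod.mk.injEq]
            constructor
            · rintro ⟨-, -, h3, h4⟩
              exact ⟨h3, Fin.ext (by omega)⟩
            · rintro ⟨rfl, rfl⟩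
              exact ⟨h1, by rwa [Sym2.eq_swap], rfl, hj'⟩
          · intro hb
            rw [Set.eq_empty_iff_forall_notMem]
            rintro ⟨x, y⟩ ⟨h1, h2, h3, h4⟩
            dsimp only at h3 h4
            subst h3
            rw [Sym2.eq_swap] at h2
            have h5 := (hB.horiz x y j h4).2 h2
            have h6 := (hD.testBit x y).2 h1
            rw [h4] at h6
            simp [h5, h6] at hb
        · apply Set.ncard_eq_toNat
          · intro hb
            rw [Bool.and_eq_true] at hb
            obtain ⟨j', hj'⟩ : ∃ j' : Fin n, j.val + 1 = j'.val := by
              rcases Nat.lt_or_ge (j.val + 1) n with h0 | h0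
              · exact ⟨⟨j.val + 1, h0⟩, rfl⟩
              · have h1 : j.val + 2 = n + 1 := by omega
                simp [h1, hD.last] at hb
            have h1 := hb.1
            rw [show j.val + 2 = j'.val + 1 by omega, hD.testBit] at h1
            have h2 := hb.2
            rw [hj', hB.horiz i j j' hj'] at h2
            refine ⟨(i, j'), ?_⟩
            ext ⟨x, y⟩
            simp only [Set.mem_ofPred_eq, Set.mem_singleton_iff, Prod.mk.injEq]
            constructor
            · rintro ⟨-, -, h3, h4⟩
              exact ⟨h3, Fin.ext (by omega)⟩
            · rintro ⟨rfl, rfl⟩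
              exact ⟨h1, h2, rfl, hj'⟩
          · intro hb
            rw [Set.eq_empty_iff_forall_notMem]
            rintro ⟨x, y⟩ ⟨h1, h2, h3, h4⟩
            dsimp only at h3 h4
            subst h3
            have h5 := (hB.horiz x j y h4).2 h2
            have h6 := (hD.testBit x y).2 h1
            rw [← h4] at h5 h6
            simp [h5, h6] at hb
      · apply Set.ncard_eq_toNat
        · intro hb
          simp only [Bool.and_eq_true, decide_eq_true_eq] at hb
          obtain ⟨⟨h0, h1⟩, h2⟩ := hb
          obtain ⟨i', hi'⟩ : ∃ i' : Fin 4, i'.val + 1 = i.val :=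
            ⟨⟨i.val - 1, by omega⟩, Nat.succ_pred_eq_of_pos h0⟩
          rw [show i.val - 1 = i'.val by omega] at h1 h2
          rw [hD.testBit] at h1
          rw [hB.vert i' i j hi'] at h2
          refine ⟨(i', j), ?_⟩
          ext ⟨x, y⟩
          simp only [Set.mem_ofPred_eq, Set.mem_singleton_iff, Prod.mk.injEq]
          constructor
          · rintro ⟨-, -, h3, h4⟩
            exact ⟨Fin.ext (by omega), h3⟩
          · rintro ⟨rfl, rfl⟩
            exact ⟨h1, by rwa [Sym2.eq_swap], rfl, hi'⟩
        · intro hb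
          rw [Set.eq_empty_iff_forall_notMem]
          rintro ⟨x, y⟩ ⟨h1, h2, h3, h4⟩
          dsimp only at h3 h4
          subst h3
          rw [Sym2.eq_swap] at h2
          have h5 := (hB.vert x i y h4).2 h2
          have h6 := (hD.testBit x y).2 h1
          rw [← h4] at hb
          simp [h5, h6] at hb
    · apply Set.ncard_eq_toNat
      · intro hb
        simp only [Bool.and_eq_true, decide_eq_true_eq] at hb
        obtain ⟨⟨h0, h1⟩, h2⟩ := hb
        obtain ⟨i', hi'⟩ : ∃ i' : Fin 4, i.val + 1 = i'.val :=
          ⟨⟨i.val + 1, by omega⟩, rfl⟩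
        rw [hi', hD.testBit] at h1
        rw [hB.vert i i' j hi'] at h2
        refine ⟨(i', j), ?_⟩
        ext ⟨x, y⟩
        simp only [Set.mem_ofPred_eq, Set.mem_singleton_iff, Prod.mk.injEq]
        constructor
        · rintro ⟨-, -, h3, h4⟩
          exact ⟨Fin.ext (by omega), h3⟩
        · rintro ⟨rfl, rfl⟩
          exact ⟨h1, h2, rfl, hi'⟩
      · intro hb
        rw [Set.eq_empty_iff_forall_notMem]
        rintro ⟨x, y⟩ ⟨h1, h2, h3, h4⟩
        dsimp only at h3 h4
        subst h3
        have h5 := (hB.vert i x y h4).2 h2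
        have h6 := (hD.testBit x y).2 h1
        rw [← h4] at h6
        have h7 : i.val < 3 := by omega
        simp [h5, h6, h7] at hb
  all_goals
    rw [Set.disjoint_left]
    rintro ⟨x, y⟩
    simp only [Set.mem_union, Set.mem_ofPred_eq, Fin.ext_iff]
    omega

theorem isPDominating_two_iff {n : ℕ} {B : Set (Sym2 (Fin 4 × Fin n))} {v h c : ℕ → ℕ}
    {D : Finset (Fin 4 × Fin n)} (hB : IsEdgeMask n B v h) (hD : IsColumnMask D c) :
    IsPDominating ((gridGraph 4 n).deleteEdges B) 2 D ↔
      ∀ j < n, columnOK (v j) (h j) (h (j + 1)) (c j) (c (j + 1)) (c (j + 2)) = true := by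
  constructor
  · intro hdom j hj
    rw [columnOK_iff]
    intro i hi
    have hmem : (i, (⟨j, hj⟩ : Fin n)) ∉ D := by
      rw [← hD.testBit]
      simp [hi]
    have := hdom _ hmem
    rwa [ncard_inter_neighborSet hB hD] at this
  · rintro hok ⟨i, j⟩ hij
    rw [ncard_inter_neighborSet hB hD]
    refine columnOK_iff.1 (hok j j.2) i ?_
    rw [← hD.testBit] at hij
    simpa using hij

/-- The number of elements of a four-bit mask. -/
def maskCard (b : ℕ) : ℕ :=
  (b.testBit 0).toNat + (b.testBit 1).toNat + (b.testBit 2).toNat + (b.testBit 3).toNat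

theorem IsColumnMask.card_eq {n : ℕ} {D : Finset (Fin 4 × Fin n)} {c : ℕ → ℕ}
    (hD : IsColumnMask D c) : D.card = ∑ j ∈ Finset.range n, maskCard (c (j + 1)) := by
  have h1 : D.card = ∑ x : Fin 4 × Fin n, if x ∈ D then 1 else 0 := by simp
  rw [h1, Fintype.sum_prod_type_right, Finset.sum_range]
  refine Finset.sum_congr rfl fun j _ => ?_
  have h2 : ∀ i : Fin 4, (if (i, j) ∈ D then 1 else 0) = ((c (j + 1)).testBit i).toNat := by
    intro i
    split_ifs with h
    · rw [(hD.testBit i j).2 h]; rfl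
    · rw [← hD.testBit, Bool.not_eq_true] at h
      rw [h]; rfl
  simp only [h2, Fin.sum_univ_four, maskCard]
  rfl

theorem exists_isColumnMask {n : ℕ} (D : Finset (Fin 4 × Fin n)) :
    ∃ c, IsColumnMask D c ∧ ∀ j, c j < 16 := by
  classical
  let b : Fin 4 → ℕ → ℕ := fun i j =>
    (decide (∃ j' : Fin n, j'.val + 1 = j ∧ (i, j') ∈ D)).toNat
  have hb : ∀ i j, b i j ≤ 1 := fun i j => Bool.toNat_le _
  have hlt : ∀ p q r s : ℕ, p < 2 → q < 2 → r < 2 → s < 2 → ∀ i : Fin 4,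
      (p + 2 * q + 4 * r + 8 * s).testBit i = decide (![p, q, r, s] i = 1) := by
    intro p q r s hp hq hr hs
    interval_cases p <;> interval_cases q <;> interval_cases r <;> interval_cases s <;> decide
  refine ⟨fun j => b 0 j + 2 * b 1 j + 4 * b 2 j + 8 * b 3 j, ⟨?_, ?_, ?_⟩, ?_⟩
  · simp [b]
  · have : ∀ i : Fin 4, b i (n + 1) = 0 := by
      intro i
      rw [Bool.toNat_eq_zero, decide_eq_false_iff_not]
      rintro ⟨j', h, -⟩
      omega
    simp only [this]
  · intro i j
    have h : ∀ i, b i (j + 1) < 2 := fun i => Nat.lt_succ_of_le (hb _ _)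
    rw [hlt _ _ _ _ (h 0) (h 1) (h 2) (h 3), decide_eq_true_eq]
    have h2 : ![b 0 (j + 1), b 1 (j + 1), b 2 (j + 1), b 3 (j + 1)] i = b i (j + 1) := by
      fin_cases i <;> rfl
    have h3 : (∃ j' : Fin n, j'.val + 1 = j.val + 1 ∧ (i, j') ∈ D) ↔ (i, j) ∈ D := by
      constructor
      · rintro ⟨j', h4, h5⟩
        rwa [show j = j' from Fin.ext (by omega)]
      · exact fun h => ⟨j, rfl, h⟩
    rw [h2, ← h3]
    simp only [b]
    rw [Bool.toNat_eq_one, decide_eq_true_eq]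
  · intro j
    have h0 := hb 0 j
    have h1 := hb 1 j
    have h2 := hb 2 j
    have h3 := hb 3 j
    dsimp only
    omega

/-! ### Potentials for lower bounds -/

/-- The entry in row `a` and column `b` of a table whose rows are written in hexadecimal, the
last digit being the first entry. -/
def hexEntry (t : List ℕ) (a b : ℕ) : ℕ := (t.getD a 0 >>> (4 * b)) % 16

/-- If two consecutive columns have masks `a` and `b`, and the column `b` is dominated, then `t`
at `(a, b)` exceeds `t'` at `(b, c)` by at most the excess of the next column `c` over `7 / 4`,
in units of `1 / 4`. -/
def IsPotentialStep (v hl hr : ℕ) (t t' : List ℕ) : Prop :=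
  ∀ a < 16, ∀ b < 16, ∀ c < 16, columnOK v hl hr a b c = true →
    hexEntry t a b + 7 ≤ 4 * maskCard c + hexEntry t' b c

instance (v hl hr : ℕ) (t t' : List ℕ) : Decidable (IsPotentialStep v hl hr t t') := by
  unfold IsPotentialStep
  infer_instance

/-- Telescoping: the cost so far plus the potential never falls below its initial bound. The 1 added
to all table entries enters through `hstart` and is given back by `hend`. -/
theorem le_sum_maskCard_of_potential {n K : ℕ} {v h c : ℕ → ℕ} (T : ℕ → List ℕ) (hn : 0 < n)
    (hok : ∀ j < n, columnOK (v j) (h j) (h (j + 1)) (c j) (c (j + 1)) (c (j + 2)) = true)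
    (hc : ∀ j, c j < 16) (h0 : c 0 = 0) (hlast : c (n + 1) = 0)
    (hstart : ∀ b < 16, K + 8 ≤ 4 * maskCard b + hexEntry (T 0) 0 b)
    (hstep : ∀ j, IsPotentialStep (v j) (h j) (h (j + 1)) (T j) (T (j + 1)))
    (hend : ∀ a < 16, ∀ b < 16, columnOK (v (n - 1)) (h (n - 1)) (h (n - 1 + 1)) a b 0 = true →
      hexEntry (T (n - 1)) a b ≤ 1) :
    7 * n + K ≤ 4 * ∑ j ∈ Finset.range n, maskCard (c (j + 1)) := by
  have key : ∀ m < n, 7 * (m + 1) + K + 1 ≤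
      4 * ∑ j ∈ Finset.range (m + 1), maskCard (c (j + 1)) + hexEntry (T m) (c m) (c (m + 1)) := by
    intro m
    induction m with
    | zero =>
      intro _
      have := hstart (c 1) (hc 1)
      simp only [Nat.zero_add, Finset.sum_range_one, h0]
      omega
    | succ m ih =>
      intro hm
      have h1 := ih (by omega)
      have h2 := hstep m _ (hc m) _ (hc (m + 1)) _ (hc (m + 1 + 1)) (hok m (by omega))
      rw [Finset.sum_range_succ, Nat.mul_add]
      omega
  obtain ⟨m, rfl⟩ : ∃ m, n = m + 1 := ⟨n - 1, by omega⟩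
  have h1 := key m (by omega)
  have h2 := hok m (by omega)
  rw [hlast] at h2
  have h3 := hend _ (hc m) _ (hc (m + 1)) h2
  rw [Nat.add_sub_cancel] at h3
  omega

/-- The smallest excess over `7 / 4` per column, in units of `1 / 4` and increased by `1`, of the
columns after two columns with given masks; entries are cut off at `15`. -/
def potential : List ℕ :=
  [0x010f022f122fffff, 0x0003012f1225ffff, 0x010f022f122fffff, 0x000201251223ffff,
   0x010f022f122fffff, 0x0003012f1225ffff, 0x010f021f122fffff, 0x000201141223ffff,
   0x010f022f021f35ff, 0x0003012f011535ff, 0x010f022f021f35ff, 0x00020125011335ff,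
   0x010f022f021f235f, 0x0003012f0115235f, 0x010f021f021f234f, 0x0002011401132349]

/-- The table `gridPotential 0`. -/
def potentialStart₀ : List ℕ :=
  [0x010f033f133fffff, 0x0003023f1335ffff, 0x010f032f133fffff, 0x000202251333ffff,
   0x010f032f133fffff, 0x0003022f1335ffff, 0x010f032f133fffff, 0x000202241333ffff,
   0x010f033f032f35ff, 0x0003023f032535ff, 0x010f032f032f35ff, 0x00020225032335ff,
   0x010f032f032f235f, 0x0003022f0325235f, 0x010f032f032f234f, 0x0002022403232349]

/-- The table `gridPotential 1`. -/
def potentialStart₁ : List ℕ :=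
  [0x010f022f122fffff, 0x0003022f1225ffff, 0x010f022f122fffff, 0x000202251223ffff,
   0x010f022f122fffff, 0x0003022f1225ffff, 0x010f022f122fffff, 0x000202241223ffff,
   0x010f022f022f35ff, 0x0003022f022535ff, 0x010f022f022f35ff, 0x00020225022335ff,
   0x010f022f022f235f, 0x0003022f0225235f, 0x010f022f022f234f, 0x0002022402232349]

/-- The table `vertPotential 0`. -/
def potentialVert₀ : List ℕ :=
  [0x020f044f244fffff, 0x0003024f2447ffff, 0x020f042f244fffff, 0x000202262444ffff,
   0x020f042f244fffff, 0x0003022f2447ffff, 0x020f042f244fffff, 0x000202252444ffff,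
   0x020f044f042f37ff, 0x0003024f042636ff, 0x020f042f042f37ff, 0x00020226042436ff,
   0x020f042f042f246f, 0x0003022f0426246f, 0x020f042f042f245f, 0x000202250424245a]

/-- The table `vertPotential 1`. -/
def potentialVert₁ : List ℕ :=
  [0x112f233f133fffff, 0x1124233f1335ffff, 0x112f233f133fffff, 0x112223351333ffff,
   0x112f233f133fffff, 0x1124233f1335ffff, 0x112f233f133fffff, 0x112223351333ffff,
   0x112f233f133f45ff, 0x1124233f133545ff, 0x112f233f133f45ff, 0x11222335133345ff,
   0x112f233f133f235f, 0x1124233f1335235f, 0x112f233f133f235f, 0x1122233513332359]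

/-- The table `vertPotential 2`. -/
def potentialVert₂ : List ℕ :=
  [0x010f022f122fffff, 0x000f022f122fffff, 0x010f022f122fffff, 0x000302251225ffff,
   0x010f022f122fffff, 0x000f022f122fffff, 0x010f022f122fffff, 0x000302241225ffff,
   0x010f022f022fffff, 0x000f022f022fffff, 0x010f022f022fffff, 0x000302250225ffff,
   0x010f022f022f355f, 0x000f022f022f355f, 0x010f022f022f354f, 0x0003022402253549]

/-- The table `pairPotential 0`. -/
def potentialPair₀ : List ℕ :=
  [0x333f377f377fffff, 0x3337337f3777ffff, 0x333f373f377fffff, 0x333333373777ffff,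
   0x333f373f377fffff, 0x3337333f3777ffff, 0x333f373f377fffff, 0x333333373777ffff,
   0x333f377f373f77ff, 0x3337337f373777ff, 0x333f373f373f77ff, 0x33333337373777ff,
   0x333f373f373f377f, 0x3337333f3737377f, 0x333f373f373f377f, 0x333333373737377b]

/-- The table `pairPotential 1`. -/
def potentialPair₁ : List ℕ :=
  [0x262f266f666fffff, 0x2226266f6666ffff, 0x262f266f666fffff, 0x222626666666ffff,
   0x262f266f666fffff, 0x2226266f6666ffff, 0x262f266f666fffff, 0x222626666666ffff,
   0x262f266f266f66ff, 0x2226266f266666ff, 0x262f266f266f66ff, 0x22262666266666ff,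
   0x262f266f266f666f, 0x2226266f2666666f, 0x262f266f266f666f, 0x222626662666666a]

/-- The table `pairPotential 2`. -/
def potentialPair₂ : List ℕ :=
  [0x151f155f555fffff, 0x1115155f5559ffff, 0x151f155f555fffff, 0x111515595555ffff,
   0x151f155f555fffff, 0x1115155f5559ffff, 0x151f155f555fffff, 0x111515595555ffff,
   0x151f155f155f59ff, 0x1115155f155959ff, 0x151f155f155f59ff, 0x11151559155559ff,
   0x151f155f155f559f, 0x1115155f1559559f, 0x151f155f155f559f, 0x111515591555559d]

/-- The table `pairPotential 3`. -/
def potentialPair₃ : List ℕ :=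
  [0x444f444f444fffff, 0x4448444f4448ffff, 0x444f444f444fffff, 0x444444484444ffff,
   0x444f444f444fffff, 0x4448444f4448ffff, 0x444f444f444fffff, 0x444444484444ffff,
   0x444f444f444f88ff, 0x4448444f444888ff, 0x444f444f444f88ff, 0x44444448444488ff,
   0x444f444f444f448f, 0x4448444f4448448f, 0x444f444f444f448f, 0x444444484444448c]

/-- The table `pairPotential 4`. -/
def potentialPair₄ : List ℕ :=
  [0x3f3f3f3fffffffff, 0x333f333fffffffff, 0x3f3f3f3fffffffff, 0x333f333fffffffff,
   0x3f3f3f3fffffffff, 0x333f333fffffffff, 0x3f3f3f3fffffffff, 0x333f333fffffffff,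
   0x3f3f3f3f3f3fffff, 0x333f333f333fffff, 0x3f3f3f3f3f3fffff, 0x333f333f333fffff,
   0x3f3f3f3f3f3fffff, 0x333f333f333fffff, 0x3f3f3f3f3f3fffff, 0x333f333f333fffff]

/-- The table `pairPotential 5`. -/
def potentialPair₅ : List ℕ :=
  [0x010f022f122fffff, 0x010f022f122fffff, 0x010f022f122fffff, 0x010f022f122fffff,
   0x010f022f122fffff, 0x010f022f122fffff, 0x010f022f122fffff, 0x010f022f122fffff,
   0x010f022f122fffff, 0x010f022f122fffff, 0x010f022f122fffff, 0x010f022f122fffff,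
   0x010f022f122fffff, 0x010f022f122fffff, 0x010f022f122fffff, 0x010f022f122fffff]

/-- One stationary table serves all columns far enough from the left end, so a single finite check
covers every n. -/
theorem isPotentialStep_potential : IsPotentialStep 7 15 15 potential potential := by
  decide +kernel

theorem hexEntry_potential_le :
    ∀ a < 16, ∀ b < 16, columnOK 7 15 15 a b 0 = true → hexEntry potential a b ≤ 1 := by
  decide +kernel

/-- The potentials that bound the `2`-domination number of the grid. -/
def gridPotential : ℕ → List ℕ
  | 0 => potentialStart₀
  | 1 => potentialStart₁
  | _ => potential

theorem isPotentialStep_gridPotential (j : ℕ) :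
    IsPotentialStep 7 15 15 (gridPotential j) (gridPotential (j + 1)) := by
  match j with
  | 0 => decide +kernel
  | 1 => decide +kernel
  | _ + 2 => exact isPotentialStep_potential

/-- The potentials for the grid without the edge between rows `1` and `2` of column `2`. -/
def vertPotential : ℕ → List ℕ
  | 0 => potentialVert₀
  | 1 => potentialVert₁
  | 2 => potentialVert₂
  | _ => potential

theorem isPotentialStep_vertPotential (j : ℕ) :
    IsPotentialStep (if j = 2 then 5 else 7) 15 15 (vertPotential j) (vertPotential (j + 1)) := by
  match j with
  | 0 => decide +kernel
  | 1 => decide +kernel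
  | 2 => decide +kernel
  | j + 3 =>
    rw [if_neg (by omega)]
    exact isPotentialStep_potential

/-- The potentials for the grid without the edges between columns `4` and `5` in the first and in
the last row. -/
def pairPotential : ℕ → List ℕ
  | 0 => potentialPair₀
  | 1 => potentialPair₁
  | 2 => potentialPair₂
  | 3 => potentialPair₃
  | 4 => potentialPair₄
  | 5 => potentialPair₅
  | _ => potential

/-- The deleted pair is recorded in the mask with index 5, which is the right mask at column 4 and
the left mask at column 5. -/
theorem isPotentialStep_pairPotential (j : ℕ) :
    IsPotentialStep 7 (if j = 5 then 6 else 15) (if j + 1 = 5 then 6 else 15)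
      (pairPotential j) (pairPotential (j + 1)) := by
  match j with
  | 0 => decide +kernel
  | 1 => decide +kernel
  | 2 => decide +kernel
  | 3 => decide +kernel
  | 4 => decide +kernel
  | 5 => decide +kernel
  | j + 6 =>
    rw [if_neg (by omega), if_neg (by omega)]
    exact isPotentialStep_potential

/-! ### Edge masks after deletions -/

theorem isEdgeMask_empty (n : ℕ) : IsEdgeMask n ∅ (fun _ => 7) (fun _ => 15) := by
  constructor
  · intro i k j hik
    have : i = 0 ∨ i = 1 ∨ i = 2 := by omega
    rcases this with rfl | rfl | rfl <;> simp <;> decide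
  · intro i j k _
    fin_cases i <;> simp <;> decide

theorem isEdgeMask_vert {n : ℕ} (i k : Fin 4) (j : Fin n) (hik : i.val + 1 = k.val) :
    IsEdgeMask n {s((i, j), (k, j))} (fun x => if x = j then 7 - 2 ^ i.val else 7)
      (fun _ => 15) := by
  constructor
  · intro i' k' j' hik'
    have hbit : ∀ i i' : Fin 4, i.val < 3 → i'.val < 3 →
        ((7 - 2 ^ i.val).testBit i' = true ↔ i ≠ i') := by decide
    have hbit7 : ∀ i' : Fin 4, i'.val < 3 → Nat.testBit 7 i' = true := by decide
    rw [Set.mem_singleton_iff, Sym2.eq_iff]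
    simp only [Prod.mk.injEq]
    split_ifs with h
    · rw [hbit i i' (by omega) (by omega)]
      simp only [Fin.ext_iff] at h ⊢
      omega
    · simp only [hbit7 i' (by omega), Fin.ext_iff, true_iff]
      omega
  · intro i' j' k' hjk
    have hbit : ∀ i' : Fin 4, Nat.testBit 15 i' = true := by decide
    rw [Set.mem_singleton_iff, Sym2.eq_iff]
    simp only [Prod.mk.injEq, hbit, Fin.ext_iff, true_iff]
    omega

theorem isEdgeMask_horiz {n : ℕ} (i : Fin 4) (j k : Fin n) (hjk : j.val + 1 = k.val) :
    IsEdgeMask n {s((i, j), (i, k))} (fun _ => 7)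
      (fun x => if x = k then 15 - 2 ^ i.val else 15) := by
  constructor
  · intro i' k' j' hik'
    have hbit7 : ∀ i' : Fin 4, i'.val < 3 → Nat.testBit 7 i' = true := by decide
    rw [Set.mem_singleton_iff, Sym2.eq_iff]
    simp only [Prod.mk.injEq, hbit7 i' (by omega), Fin.ext_iff, true_iff]
    omega
  · intro i' j' k' hjk'
    have hbit : ∀ i i' : Fin 4, ((15 - 2 ^ i.val).testBit i' = true ↔ i ≠ i') := by decide
    have hbit15 : ∀ i' : Fin 4, Nat.testBit 15 i' = true := by decide
    rw [Set.mem_singleton_iff, Sym2.eq_iff]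
    simp only [Prod.mk.injEq]
    split_ifs with h
    · rw [hbit i i']
      simp only [Fin.ext_iff] at h ⊢
      omega
    · simp only [hbit15 i', Fin.ext_iff, true_iff]
      omega

theorem isEdgeMask_horiz_pair {n : ℕ} (j k : Fin n) (hjk : j.val + 1 = k.val) :
    IsEdgeMask n {s((0, j), (0, k)), s((3, j), (3, k))} (fun _ => 7)
      (fun x => if x = k then 6 else 15) := by
  constructor
  · intro i' k' j' hik'
    have hbit7 : ∀ i' : Fin 4, i'.val < 3 → Nat.testBit 7 i' = true := by decide
    rw [Set.mem_insert_iff, Set.mem_singleton_iff, Sym2.eq_iff, Sym2.eq_iff]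
    simp only [Prod.mk.injEq, hbit7 i' (by omega), Fin.ext_iff, true_iff]
    omega
  · intro i' j' k' hjk'
    have hbit : ∀ i' : Fin 4, (Nat.testBit 6 i' = true ↔ i' ≠ 0 ∧ i' ≠ 3) := by decide
    have hbit15 : ∀ i' : Fin 4, Nat.testBit 15 i' = true := by decide
    rw [Set.mem_insert_iff, Set.mem_singleton_iff, Sym2.eq_iff, Sym2.eq_iff]
    simp only [Prod.mk.injEq]
    split_ifs with h
    · rw [hbit i']
      simp only [Fin.ext_iff, ne_eq] at h ⊢
      have h3 : ((3 : Fin 4) : ℕ) = 3 := rfl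
      have h0 : ((0 : Fin 4) : ℕ) = 0 := rfl
      omega
    · simp only [hbit15 i', Fin.ext_iff, true_iff]
      omega

/-! ### The three lower bounds -/

theorem le_card_of_isPDominating_grid {n : ℕ} (hn : 3 ≤ n) {D : Finset (Fin 4 × Fin n)}
    (hD : IsPDominating (gridGraph 4 n) 2 D) : 7 * n + 3 ≤ 4 * D.card := by
  obtain ⟨c, hc, hlt⟩ := exists_isColumnMask D
  rw [← SimpleGraph.deleteEdges_empty (G := gridGraph 4 n),
    isPDominating_two_iff (isEdgeMask_empty n) hc] at hD
  rw [hc.card_eq]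
  refine le_sum_maskCard_of_potential gridPotential (by omega) hD hlt hc.first hc.last
    (by decide +kernel) isPotentialStep_gridPotential ?_
  -- The last column must lie where the stationary table is in force. The bound does fail for n = 2,
  -- where the masks 10, 5 give a 2-dominating set of 4 vertices.
  obtain ⟨m, rfl⟩ : ∃ m, n = m + 3 := ⟨n - 3, by omega⟩
  exact hexEntry_potential_le

/-- The gain over the intact grid is only a quarter of a vertex, which matters when 4 divides 7n+3.
-/
theorem le_card_of_isPDominating_deleteEdges_vert {n : ℕ} (hn : 4 ≤ n)
    {D : Finset (Fin 4 × Fin n)} (hD : IsPDominating ((gridGraph 4 n).deleteEdges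
      {s((1, ⟨2, by omega⟩), (2, ⟨2, by omega⟩))}) 2 D) : 7 * n + 4 ≤ 4 * D.card := by
  obtain ⟨c, hc, hlt⟩ := exists_isColumnMask D
  rw [isPDominating_two_iff (isEdgeMask_vert 1 2 ⟨2, by omega⟩ rfl) hc] at hD
  rw [hc.card_eq]
  refine le_sum_maskCard_of_potential vertPotential (by omega) hD hlt hc.first hc.last
    (by decide +kernel) isPotentialStep_vertPotential ?_
  obtain ⟨m, rfl⟩ : ∃ m, n = m + 4 := ⟨n - 4, by omega⟩
  exact hexEntry_potential_le

/-- Here the gain over the intact grid is a whole vertex, so the residue of n plays no role. -/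
theorem le_card_of_isPDominating_deleteEdges_horiz_pair {n : ℕ} (hn : 7 ≤ n)
    {D : Finset (Fin 4 × Fin n)} (hD : IsPDominating ((gridGraph 4 n).deleteEdges
      {s((0, ⟨4, by omega⟩), (0, ⟨5, by omega⟩)), s((3, ⟨4, by omega⟩), (3, ⟨5, by omega⟩))}) 2 D) :
    7 * n + 7 ≤ 4 * D.card := by
  obtain ⟨c, hc, hlt⟩ := exists_isColumnMask D
  rw [isPDominating_two_iff (isEdgeMask_horiz_pair ⟨4, by omega⟩ ⟨5, by omega⟩ rfl) hc] at hD
  rw [hc.card_eq]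
  refine le_sum_maskCard_of_potential pairPotential (by omega) hD hlt hc.first hc.last
    (by decide +kernel) isPotentialStep_pairPotential ?_
  obtain ⟨m, rfl⟩ : ∃ m, n = m + 7 := ⟨n - 7, by omega⟩
  exact hexEntry_potential_le

/-! ### Optimal sets and their shifts -/

/-- The mask with the rows in reverse order. -/
def flipMask (b : ℕ) : ℕ :=
  (b.testBit 3).toNat + 2 * (b.testBit 2).toNat + 4 * (b.testBit 1).toNat + 8 * (b.testBit 0).toNat

/-- The mask with the rows in reverse order if `f` is true. -/
def flipIf (f : Bool) (b : ℕ) : ℕ := if f then flipMask b else b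

theorem maskCard_flipIf (f : Bool) (b : ℕ) : maskCard (flipIf f b) = maskCard b := by
  cases f
  · rfl
  · rw [flipIf, if_pos rfl, flipMask, maskCard, maskCard]
    cases b.testBit 0 <;> cases b.testBit 1 <;> cases b.testBit 2 <;> cases b.testBit 3 <;> rfl

/-- The column masks, shifted by one, of a minimum `2`-dominating set of the `4 × n` grid: `s`
alternating columns, then a pattern of period `8`, then alternating columns again. -/
def gridColumn (n s j : ℕ) : ℕ :=
  if j = 0 ∨ n < j then 0
  else if j ≤ s then if (s - j) % 2 = 0 then 10 else 5
  else if 4 * ((n + 1) / 4) + s < j + 2 then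
    if (j - (s + 1) + (n + 1) / 4) % 2 = 0 then 5 else 10
  else if j = s + 1 then 5
  else [4, 9, 2, 13, 2, 9, 4, 11].getD ((j - (s + 1)) % 8) 0

/-- Adding 8 to n raises `(n + 1) / 4` by 2, which preserves the parity choosing between 5 and 10 at
the right end. Column `s + 1` is excluded because its mask 5 replaces the periodic entry 4. -/
theorem gridColumn_add_eight_left {n s j : ℕ} (hj : s + 2 ≤ j) :
    gridColumn (n + 8) s (j + 8) = gridColumn n s j := by
  have h1 : (n + 8 + 1) / 4 = (n + 1) / 4 + 2 := by omega
  have h2 : j + 8 - (s + 1) = j - (s + 1) + 8 := by omega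
  have h3 : (j - (s + 1) + 8 + ((n + 1) / 4 + 2)) % 2 = (j - (s + 1) + (n + 1) / 4) % 2 := by omega
  have e1 : (j + 8 = 0 ∨ n + 8 < j + 8) ↔ (j = 0 ∨ n < j) := by omega
  have e2 : (4 * ((n + 1) / 4 + 2) + s < j + 8 + 2) ↔ (4 * ((n + 1) / 4) + s < j + 2) := by omega
  rw [gridColumn, gridColumn, h1, h2, h3, Nat.add_mod_right]
  simp only [e1, e2]
  rw [if_neg (show ¬ j + 8 ≤ s by omega), if_neg (show ¬ j ≤ s by omega),
    if_neg (show ¬ j + 8 = s + 1 by omega), if_neg (show ¬ j = s + 1 by omega)]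

/-- The right-hand alternating part starts at column 4⌊(n+1)/4⌋ + s - 1 ≥ n - 3, so columns up to n
- 4 do not see it. -/
theorem gridColumn_add_eight_right {n s j : ℕ} (hj : j + 4 ≤ n) :
    gridColumn (n + 8) s j = gridColumn n s j := by
  have e1 : (j = 0 ∨ n + 8 < j) ↔ (j = 0 ∨ n < j) := by omega
  have e2 : (4 * ((n + 8 + 1) / 4) + s < j + 2) ↔ (4 * ((n + 1) / 4) + s < j + 2) := by omega
  have h1 : (n + 8 + 1) / 4 = (n + 1) / 4 + 2 := by omega
  have h3 : (j - (s + 1) + ((n + 1) / 4 + 2)) % 2 = (j - (s + 1) + (n + 1) / 4) % 2 := by omega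
  rw [gridColumn, gridColumn]
  simp only [e1, e2]
  rw [h1, h3]

/-- Eight columns can be cut out away from any window of four masks, on its left or on its right.
Four masks are what the two columns meeting a horizontal edge see. -/
theorem exists_gridColumn_window (n : ℕ) (hn : 7 ≤ n) : ∀ j < n, ∃ n' < 27, ∃ j' < n', 7 ≤ n' ∧
    n' % 4 = n % 4 ∧ (j + 1 < n → j' + 1 < n') ∧
    ∀ s < 4, ∀ k < 4, gridColumn n s (j + k) = gridColumn n' s (j' + k) := by
  induction n using Nat.strong_induction_on with
  | _ n ih =>
    intro j hj
    rcases Nat.lt_or_ge n 27 with h | h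
    · exact ⟨n, h, j, hj, hn, rfl, id, fun _ _ _ _ => rfl⟩
    · obtain ⟨m, rfl⟩ : ∃ m, n = m + 8 := ⟨n - 8, by omega⟩
      rcases Nat.lt_or_ge m (j + 7) with h1 | h1
      · obtain ⟨i, rfl⟩ : ∃ i, j = i + 8 := ⟨j - 8, by omega⟩
        obtain ⟨n', hn', j', hj', h7, hmod, hs, hw⟩ := ih m (by omega) (by omega) i (by omega)
        refine ⟨n', hn', j', hj', h7, by omega, fun h => hs (by omega), fun s hs k hk => ?_⟩
        rw [← hw s hs k hk, Nat.add_right_comm, gridColumn_add_eight_left (by omega)]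
      · obtain ⟨n', hn', j', hj', h7, hmod, hs, hw⟩ := ih m (by omega) (by omega) j (by omega)
        refine ⟨n', hn', j', hj', h7, by omega, fun h => hs (by omega), fun s hs k hk => ?_⟩
        rw [← hw s hs k hk, gridColumn_add_eight_right (by omega)]

theorem columnOK_gridColumn {n s j : ℕ} (f : Bool) (hn : 7 ≤ n) (hs : s < (n + 1) % 4 + 1)
    (hj : j < n) : columnOK 7 15 15 (flipIf f (gridColumn n s j))
      (flipIf f (gridColumn n s (j + 1))) (flipIf f (gridColumn n s (j + 2))) = true := by
  have base : ∀ n < 27, ∀ j < n, 7 ≤ n → ∀ s < (n + 1) % 4 + 1, ∀ f : Bool,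
      columnOK 7 15 15 (flipIf f (gridColumn n s (j + 0))) (flipIf f (gridColumn n s (j + 1)))
        (flipIf f (gridColumn n s (j + 2))) = true := by
    decide +kernel
  obtain ⟨n', hn', j', hj', h7, hmod, -, hw⟩ := exists_gridColumn_window n hn j hj
  have h := base n' hn' j' hj' h7 s (by omega) f
  rwa [← hw s (by omega) 0 (by omega), ← hw s (by omega) 1 (by omega),
    ← hw s (by omega) 2 (by omega)] at h

-- Only the column of the deleted edge can lose domination, so only that column is tested. Since n
-- is not 3 mod 4, at least two shifts s are available.
set_option synthInstance.maxSize 1000 in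
theorem exists_columnOK_vert {n i j : ℕ} (hn : 7 ≤ n) (hmod : n % 4 ≠ 3) (hi : i < 3)
    (hj : j < n) : ∃ s < (n + 1) % 4 + 1, ∃ f : Bool,
      columnOK (7 - 2 ^ i) 15 15 (flipIf f (gridColumn n s j))
        (flipIf f (gridColumn n s (j + 1))) (flipIf f (gridColumn n s (j + 2))) = true := by
  have base : ∀ n < 27, ∀ j < n, 7 ≤ n → n % 4 ≠ 3 → ∀ i < 3, ∃ s < (n + 1) % 4 + 1, ∃ f : Bool,
      columnOK (7 - 2 ^ i) 15 15 (flipIf f (gridColumn n s (j + 0)))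
        (flipIf f (gridColumn n s (j + 1))) (flipIf f (gridColumn n s (j + 2))) = true := by
    decide +kernel
  obtain ⟨n', hn', j', hj', h7, hmod', -, hw⟩ := exists_gridColumn_window n hn j hj
  obtain ⟨s, hs, f, h⟩ := base n' hn' j' hj' h7 (by omega) i hi
  refine ⟨s, by omega, f, ?_⟩
  rwa [← hw s (by omega) 0 (by omega), ← hw s (by omega) 1 (by omega),
    ← hw s (by omega) 2 (by omega)] at h

set_option synthInstance.maxSize 1000 in
theorem exists_columnOK_horiz {n i j : ℕ} (hn : 7 ≤ n) (hmod : n % 4 ≠ 3) (hi : i < 4)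
    (hj : j + 1 < n) : ∃ s < (n + 1) % 4 + 1, ∃ f : Bool,
      columnOK 7 15 (15 - 2 ^ i) (flipIf f (gridColumn n s j))
        (flipIf f (gridColumn n s (j + 1))) (flipIf f (gridColumn n s (j + 2))) = true ∧
      columnOK 7 (15 - 2 ^ i) 15 (flipIf f (gridColumn n s (j + 1)))
        (flipIf f (gridColumn n s (j + 2))) (flipIf f (gridColumn n s (j + 3))) = true := by
  have base : ∀ n < 27, ∀ j < n, 7 ≤ n → n % 4 ≠ 3 → j + 1 < n → ∀ i < 4,
      ∃ s < (n + 1) % 4 + 1, ∃ f : Bool,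
      columnOK 7 15 (15 - 2 ^ i) (flipIf f (gridColumn n s (j + 0)))
        (flipIf f (gridColumn n s (j + 1))) (flipIf f (gridColumn n s (j + 2))) = true ∧
      columnOK 7 (15 - 2 ^ i) 15 (flipIf f (gridColumn n s (j + 1)))
        (flipIf f (gridColumn n s (j + 2))) (flipIf f (gridColumn n s (j + 3))) = true := by
    decide +kernel
  obtain ⟨n', hn', j', hj', h7, hmod', hj1, hw⟩ := exists_gridColumn_window n hn j (by omega)
  obtain ⟨s, hs, f, h⟩ := base n' hn' j' hj' h7 (by omega) (hj1 hj) i hi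
  refine ⟨s, by omega, f, ?_⟩
  rwa [← hw s (by omega) 0 (by omega), ← hw s (by omega) 1 (by omega),
    ← hw s (by omega) 2 (by omega), ← hw s (by omega) 3 (by omega)] at h

/-- Any eight consecutive columns of the periodic part hold 14 vertices, matching the growth 7/4 per
column, so the count reduces to small n. -/
theorem sum_maskCard_gridColumn (n s : ℕ) (hn : 7 ≤ n) (hs : s < (n + 1) % 4 + 1) :
    ∑ j ∈ Finset.range n, maskCard (gridColumn n s (j + 1)) = (7 * n + 6) / 4 := by
  induction n using Nat.strong_induction_on with
  | _ n ih =>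
    rcases Nat.lt_or_ge n 23 with h | h
    · have base : ∀ n < 23, 7 ≤ n → ∀ s < (n + 1) % 4 + 1,
          ∑ j ∈ Finset.range n, maskCard (gridColumn n s (j + 1)) = (7 * n + 6) / 4 := by
        decide +kernel
      exact base n h hn s hs
    · obtain ⟨m, rfl⟩ : ∃ m, n = 4 + 8 + m := ⟨n - 12, by omega⟩
      have h1 := ih (4 + m) (by omega) (by omega) (by omega)
      have hN : 4 + 8 + m = 4 + m + 8 := by omega
      rw [Finset.sum_range_add] at h1 ⊢
      rw [Finset.sum_range_add]
      have hl : ∀ j ∈ Finset.range 4, maskCard (gridColumn (4 + 8 + m) s (j + 1)) =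
          maskCard (gridColumn (4 + m) s (j + 1)) := by
        intro j hj
        rw [Finset.mem_range] at hj
        rw [hN, gridColumn_add_eight_right (by omega)]
      have hr : ∀ j ∈ Finset.range m, maskCard (gridColumn (4 + 8 + m) s (4 + 8 + j + 1)) =
          maskCard (gridColumn (4 + m) s (4 + j + 1)) := by
        intro j _
        rw [hN, show 4 + 8 + j + 1 = 4 + j + 1 + 8 by omega, gridColumn_add_eight_left (by omega)]
      have hm : ∀ j ∈ Finset.range 8, maskCard (gridColumn (4 + 8 + m) s (4 + j + 1)) =
          maskCard ([4, 9, 2, 13, 2, 9, 4, 11].getD ((4 + j - s) % 8) 0) := by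
        intro j hj
        rw [Finset.mem_range] at hj
        rw [gridColumn, if_neg (by omega), if_neg (by omega), if_neg (by omega),
          if_neg (by omega), Nat.add_sub_add_right]
      have hsum : ∀ s < 4, ∑ j ∈ Finset.range 8,
          maskCard ([4, 9, 2, 13, 2, 9, 4, 11].getD ((4 + j - s) % 8) 0) = 14 := by
        decide +kernel
      rw [Finset.sum_congr rfl hl, Finset.sum_congr rfl hr, Finset.sum_congr rfl hm,
        hsum s (by omega)]
      omega

theorem flipIf_zero (f : Bool) : flipIf f 0 = 0 := by cases f <;> rfl

/-- The vertex set of the grid described by `gridColumn`, with the rows reversed if `f` is true. -/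
def gridDominatingSet (n s : ℕ) (f : Bool) : Finset (Fin 4 × Fin n) :=
  Finset.univ.filter fun x => (flipIf f (gridColumn n s (x.2 + 1))).testBit x.1 = true

theorem isColumnMask_gridDominatingSet (n s : ℕ) (f : Bool) :
    IsColumnMask (gridDominatingSet n s f) fun j => flipIf f (gridColumn n s j) where
  first := by rw [gridColumn, if_pos (Or.inl rfl), flipIf_zero]
  last := by rw [gridColumn, if_pos (Or.inr (Nat.lt_succ_self n)), flipIf_zero]
  testBit i j := by simp [gridDominatingSet]

theorem card_gridDominatingSet {n s : ℕ} (f : Bool) (hn : 7 ≤ n) (hs : s < (n + 1) % 4 + 1) :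
    (gridDominatingSet n s f).card = (7 * n + 6) / 4 := by
  rw [(isColumnMask_gridDominatingSet n s f).card_eq]
  simp only [maskCard_flipIf]
  exact sum_maskCard_gridColumn n s hn hs

theorem isPDominating_gridDominatingSet {n : ℕ} (hn : 7 ≤ n) :
    IsPDominating (gridGraph 4 n) 2 (gridDominatingSet n 0 false) := by
  rw [← SimpleGraph.deleteEdges_empty (G := gridGraph 4 n),
    isPDominating_two_iff (isEdgeMask_empty n) (isColumnMask_gridDominatingSet n 0 false)]
  exact fun j hj => columnOK_gridColumn false hn (by omega) hj

theorem exists_isPDominating_deleteEdges_vert {n : ℕ} (hn : 7 ≤ n) (hmod : n % 4 ≠ 3)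
    {i k : Fin 4} (hik : i.val + 1 = k.val) (j : Fin n) :
    ∃ D, IsPDominating ((gridGraph 4 n).deleteEdges {s((i, j), (k, j))}) 2 D ∧
      D.card = (7 * n + 6) / 4 := by
  obtain ⟨s, hs, f, h⟩ := exists_columnOK_vert hn hmod (show i.val < 3 by omega) j.2
  refine ⟨gridDominatingSet n s f, ?_, card_gridDominatingSet f hn hs⟩
  rw [isPDominating_two_iff (isEdgeMask_vert i k j hik) (isColumnMask_gridDominatingSet n s f)]
  intro x hx
  split_ifs with hxj
  · rw [hxj]
    exact h
  · exact columnOK_gridColumn f hn hs hx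

theorem exists_isPDominating_deleteEdges_horiz {n : ℕ} (hn : 7 ≤ n) (hmod : n % 4 ≠ 3)
    (i : Fin 4) {j k : Fin n} (hjk : j.val + 1 = k.val) :
    ∃ D, IsPDominating ((gridGraph 4 n).deleteEdges {s((i, j), (i, k))}) 2 D ∧
      D.card = (7 * n + 6) / 4 := by
  obtain ⟨s, hs, f, h1, h2⟩ :=
    exists_columnOK_horiz hn hmod i.2 (show j.val + 1 < n by omega)
  refine ⟨gridDominatingSet n s f, ?_, card_gridDominatingSet f hn hs⟩
  rw [isPDominating_two_iff (isEdgeMask_horiz i j k hjk) (isColumnMask_gridDominatingSet n s f)]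
  intro x hx
  rcases eq_or_ne x j.val with rfl | hxj
  · rw [if_neg (by omega), if_pos hjk]
    exact h1
  · rw [if_neg (show ¬ x + 1 = k.val by omega)]
    split_ifs with hxk
    · rw [hxk, ← hjk]
      exact h2
    · exact columnOK_gridColumn f hn hs hx

/-! ### General bounds for domination and bondage numbers -/

section

variable {V : Type*} [Fintype V] {G : SimpleGraph V} {p k : ℕ}

theorem pDominationNumber_le {D : Finset V} (hD : IsPDominating G p D) :
    pDominationNumber G p ≤ D.card :=
  Nat.sInf_le ⟨D, hD, rfl⟩

theorem le_pDominationNumber (h : ∀ D : Finset V, IsPDominating G p D → k ≤ D.card) :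
    k ≤ pDominationNumber G p := by
  refine le_csInf ⟨_, Finset.univ, fun v hv => absurd (Finset.mem_univ v) hv, rfl⟩ ?_
  rintro _ ⟨D, hD, rfl⟩
  exact h D hD

theorem pBondageNumber_le {B : Finset (Sym2 V)} (hB : (B : Set (Sym2 V)) ⊆ G.edgeSet)
    (h : pDominationNumber G p < pDominationNumber (G.deleteEdges (B : Set (Sym2 V))) p) :
    pBondageNumber G p ≤ B.card :=
  Nat.sInf_le ⟨B, hB, h, rfl⟩

/-- The witness `B` is needed because the infimum of the empty set is 0. -/
theorem le_pBondageNumber {B : Finset (Sym2 V)} (hB : (B : Set (Sym2 V)) ⊆ G.edgeSet)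
    (h : pDominationNumber G p < pDominationNumber (G.deleteEdges (B : Set (Sym2 V))) p)
    (hk : ∀ B' : Finset (Sym2 V), (B' : Set (Sym2 V)) ⊆ G.edgeSet →
      pDominationNumber G p < pDominationNumber (G.deleteEdges (B' : Set (Sym2 V))) p →
      k ≤ B'.card) :
    k ≤ pBondageNumber G p := by
  refine le_csInf ⟨_, B, hB, h, rfl⟩ ?_
  rintro _ ⟨B', hB', h', rfl⟩
  exact hk B' hB' h'

theorem card_pos_of_lt_pDominationNumber_deleteEdges {B : Finset (Sym2 V)}
    (h : pDominationNumber G p < pDominationNumber (G.deleteEdges (B : Set (Sym2 V))) p) :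
    0 < B.card := by
  rw [Finset.card_pos, Finset.nonempty_iff_ne_empty]
  rintro rfl
  simp at h

end

/-! ### The domination number and the bondage number -/

theorem pDominationNumber_gridGraph_four {n : ℕ} (hn : 7 ≤ n) :
    pDominationNumber (gridGraph 4 n) 2 = (7 * n + 6) / 4 := by
  apply le_antisymm
  · rw [← card_gridDominatingSet false hn (Nat.succ_pos ((n + 1) % 4))]
    exact pDominationNumber_le (isPDominating_gridDominatingSet hn)
  · refine le_pDominationNumber fun D hD => ?_
    have := le_card_of_isPDominating_grid (by omega) hD
    omega

theorem pDominationNumber_gridGraph_four_deleteEdges_le {n : ℕ} (hn : 7 ≤ n) (hmod : n % 4 ≠ 3)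
    {e : Sym2 (Fin 4 × Fin n)} (he : e ∈ (gridGraph 4 n).edgeSet) :
    pDominationNumber ((gridGraph 4 n).deleteEdges {e}) 2 ≤ (7 * n + 6) / 4 := by
  suffices h : ∃ D, IsPDominating ((gridGraph 4 n).deleteEdges {e}) 2 D ∧
      D.card = (7 * n + 6) / 4 by
    obtain ⟨D, hD, hcard⟩ := h
    exact hcard ▸ pDominationNumber_le hD
  induction e with
  | _ x y =>
    obtain ⟨i, j⟩ := x
    obtain ⟨k, l⟩ := y
    rw [SimpleGraph.mem_edgeSet, SimpleGraph.boxProd_adj, SimpleGraph.pathGraph_adj,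
      SimpleGraph.pathGraph_adj] at he
    dsimp only at he
    rcases he with ⟨h | h, rfl⟩ | ⟨h | h, rfl⟩
    · exact exists_isPDominating_deleteEdges_vert hn hmod h j
    · rw [Sym2.eq_swap]
      exact exists_isPDominating_deleteEdges_vert hn hmod h j
    · exact exists_isPDominating_deleteEdges_horiz hn hmod i h
    · rw [Sym2.eq_swap]
      exact exists_isPDominating_deleteEdges_horiz hn hmod i h

theorem theorem5 (n : ℕ) (hn : 7 ≤ n) :
    pBondageNumber (gridGraph 4 n) 2 = if n % 4 = 3 then 1 else 2 := by
  split_ifs with hmod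
  · have hB : ((({s((1, ⟨2, by omega⟩), (2, ⟨2, by omega⟩))} : Finset (Sym2 (Fin 4 × Fin n))) :
        Set (Sym2 (Fin 4 × Fin n)))) ⊆ (gridGraph 4 n).edgeSet := by
      simp [SimpleGraph.boxProd_adj, SimpleGraph.pathGraph_adj]
    have hlt : pDominationNumber (gridGraph 4 n) 2 < pDominationNumber ((gridGraph 4 n).deleteEdges
        (({s((1, ⟨2, by omega⟩), (2, ⟨2, by omega⟩))} : Finset (Sym2 (Fin 4 × Fin n))) :
          Set (Sym2 (Fin 4 × Fin n)))) 2 := by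
      rw [pDominationNumber_gridGraph_four hn, Finset.coe_singleton, ← Nat.succ_le_iff]
      refine le_pDominationNumber fun D hD => ?_
      have := le_card_of_isPDominating_deleteEdges_vert (by omega) hD
      -- For n ≡ 3 mod 4 the quotient `(7 * n + 6) / 4` is exactly (7n+3)/4, so even one more
      -- quarter forces another vertex.
      omega
    exact le_antisymm (pBondageNumber_le hB hlt) (le_pBondageNumber hB hlt fun B' _ h' =>
      card_pos_of_lt_pDominationNumber_deleteEdges h')
  · classical
    obtain ⟨B, hBdef⟩ : ∃ B : Finset (Sym2 (Fin 4 × Fin n)),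
        B = {s((0, ⟨4, by omega⟩), (0, ⟨5, by omega⟩)),
          s((3, ⟨4, by omega⟩), (3, ⟨5, by omega⟩))} := ⟨_, rfl⟩
    have hB : (B : Set (Sym2 (Fin 4 × Fin n))) ⊆ (gridGraph 4 n).edgeSet := by
      simp [hBdef, Set.insert_subset_iff, SimpleGraph.boxProd_adj, SimpleGraph.pathGraph_adj]
    have hlt : pDominationNumber (gridGraph 4 n) 2 < pDominationNumber
        ((gridGraph 4 n).deleteEdges (B : Set (Sym2 (Fin 4 × Fin n)))) 2 := by
      rw [pDominationNumber_gridGraph_four hn, hBdef, Finset.coe_insert, Finset.coe_singleton,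
        ← Nat.succ_le_iff]
      refine le_pDominationNumber fun D hD => ?_
      have := le_card_of_isPDominating_deleteEdges_horiz_pair hn hD
      omega
    -- It remains to rule out cardinality 1, where each edge leaves an optimal set intact.
    refine le_antisymm ((pBondageNumber_le hB hlt).trans (hBdef ▸ Finset.card_le_two))
      (le_pBondageNumber hB hlt fun B' hB' h' => ?_)
    have hpos := card_pos_of_lt_pDominationNumber_deleteEdges h'
    by_contra hcard
    obtain ⟨e, rfl⟩ := Finset.card_eq_one.1 (show B'.card = 1 by omega)
    rw [Finset.coe_singleton] at hB' h'
    have := pDominationNumber_gridGraph_four_deleteEdges_le hn hmod (hB' rfl)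
    rw [pDominationNumber_gridGraph_four hn] at h'
    omega
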